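/- Let $L\ge 0$, $\Delta,G\in\mathbb R$, $\sigma_0>0$, $\theta_1>1$, $\theta_2>1$ and an integer $m\ge 1$ be given. There is a constant $C>0$, depending only on $L,\Delta,G,\sigma_0,\theta_1,\theta_2,m$ (in particular not on the dimension $n$ and not on $\epsilon_1,\epsilon_2$), such that the following holds for every $n\ge 1$, every twice continuously differentiable $f:\mathbb R^n\to\mathbb R$ that is bounded below by some $f_{\rm low}$ and whose Hessian is globally $L$-Lipschitz in the operator norm, every $x_0\in\mathbb R^n$ with $f(x_0)-f_{\rm low}\le\Delta$ and $\|\nabla f(x_0)\|\le G$, and all $\epsilon_1,\epsilon_2\in(0,1]$. Call $x$ an $(\epsilon_1,\epsilon_2)$ second-order stationary point if $\|\nabla f(x)\|\le\epsilon_1$ and $\lambda_{\min}(\nabla^2 f(x))\ge-\epsilon_2$. Consider the method AR2 that starts from $x_0,\sigma_0$ and, for $k=0,1,2,\dots$, for as long as none of $x_0,\dots,x_k$ is such a point, computes a symmetric matrix $B_k$ (rules below), then any step $s_k$ such that, with $\overline T_k(s)=f(x_k)+\nabla f(x_k)^\intercal s+\frac12 s^\intercal B_k s$ and $m_k(s)=\overline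 T_k(s)+\frac{\sigma_k}{6}\|s\|^3$, $$m_k(s_k)\le m_k(0),\qquad \|\nabla_s\overline T_k(s_k)\|\le\tfrac12\theta_1\sigma_k\|s_k\|^2,\qquad \max[0,-\lambda_{\min}(\nabla_s^2\overline T_k(s_k))]\le\theta_2\sigma_k\|s_k\|,$$ and sets $x_{k+1}=x_k+s_k$, $\sigma_{k+1}=\sigma_k+\sigma_k\|s_k\|^3$. If $m\nmid k$, then $B_k$ is the PSB update of $B_{k-1}$, that is, the minimizer of $\|B-B_{k-1}\|_F$ over the symmetric $B$ with $Bs_{k-1}=\nabla f(x_k)-\nabla f(x_{k-1})$. If $m\mid k$, then $B_k$ is recomputed in one of two ways. (1) Exact restart: $B_k=\nabla^2 f(x_k)$. Then every run of the method produces an $(\epsilon_1,\epsilon_2)$ second-order stationary point after at most $C\max[\epsilon_1^{-3/2},\epsilon_2^{-3}]$ evaluations of the gradient and at most $C\max[\epsilon_1^{-3/2},\epsilon_2^{-3}]$ evaluations of the Hessian. (2) Finite-difference restart: with the convention $\|s_j\|=1$ for $j<0$, $$h_k=\frac{\min\left(\sum_{i=1}^m\|s_{k-i}\|,1\right)}{\sqrt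 n},\qquad A_k=\sum_{i=1}^n\frac{\nabla f(x_k+h_ke_i)-\nabla f(x_k)}{h_k}\,e_i^\intercal,\qquad B_k=\tfrac12(A_k+A_k^\intercal).$$ Then every run in which the quotients are defined, i.e. $h_k>0$ at each restart made before such a point is found, produces an $(\epsilon_1,\epsilon_2)$ second-order stationary point after at most $C\,n\max[\epsilon_1^{-3/2},\epsilon_2^{-3}]$ evaluations of the gradient. No bound on the matrices $B_k$ is assumed. -/

import Mathlib

open scoped NNReal

noncomputable section

namespace AR2PSB

/-- `ℝⁿ` with the Euclidean norm. -/
abbrev E (n : ℕ) : Type := EuclideanSpace ℝ (Fin n)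

/-- Second-order tensors (matrices) on `ℝⁿ`, as operators with the operator norm; the bilinear map
of the tensor is `(u, v) ↦ ⟪u, A v⟫`. -/
abbrev Op (n : ℕ) : Type := E n →L[ℝ] E n

/-- The canonical basis vector `eᵢ`. -/
def basisVec {n : ℕ} (i : Fin n) : E n := EuclideanSpace.single i 1

/-- The Hessian `∇²f(x)`: the derivative of the gradient. -/
def hess {n : ℕ} (f : E n → ℝ) (x : E n) : Op n := fderiv ℝ (gradient f) x

/-- The leftmost (real) eigenvalue; used for symmetric operators on `ℝⁿ`, `n ≥ 1`. -/
def lambdaMin {n : ℕ} (A : Op n) : ℝ :=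
  sInf {μ : ℝ | Module.End.HasEigenvalue (A : E n →ₗ[ℝ] E n) μ}

/-- The Frobenius norm, from the entries `⟪eᵢ, A eⱼ⟫`. -/
def frobNorm {n : ℕ} (A : Op n) : ℝ :=
  Real.sqrt (∑ i : Fin n, ∑ j : Fin n, (inner ℝ (basisVec i) (A (basisVec j))) ^ 2)

/-- The projection onto symmetric operators, `(A + Aᵀ) / 2`. -/
def symPart {n : ℕ} (A : Op n) : Op n := (1 / 2 : ℝ) • (A + ContinuousLinearMap.adjoint A)

/-- `(ε₁, ε₂)` second-order stationarity. -/
def IsStationary {n : ℕ} (f : E n → ℝ) (ε₁ ε₂ : ℝ) (x : E n) : Prop :=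
  ‖gradient f x‖ ≤ ε₁ ∧ -ε₂ ≤ lambdaMin (hess f x)

/-- The inexact second-order Taylor polynomial, with `B` in place of the Hessian. -/
def approxTaylor {n : ℕ} (f : E n → ℝ) (x : E n) (B : Op n) (s : E n) : ℝ :=
  f x + inner ℝ (gradient f x) s + (1 / 2) * inner ℝ s (B s)

/-- The cubically regularized model. -/
def model {n : ℕ} (f : E n → ℝ) (x : E n) (B : Op n) (σ : ℝ) (s : E n) : ℝ :=
  approxTaylor f x B s + σ / 6 * ‖s‖ ^ 3

/-- The three requirements on a trial step: model decrease, approximate first-order optimality,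
and the bound on negative curvature. -/
def IsAcceptableStep {n : ℕ} (f : E n → ℝ) (θ₁ θ₂ : ℝ) (x : E n) (B : Op n) (σ : ℝ) (s : E n) :
    Prop :=
  model f x B σ s - model f x B σ 0 ≤ 0 ∧
  ‖gradient (approxTaylor f x B) s‖ ≤ θ₁ * σ * ‖s‖ ^ 2 / 2 ∧
  max 0 (-lambdaMin (hess (approxTaylor f x B) s)) ≤ θ₂ * σ * ‖s‖

/-- `B'` is the PSB update of `B` for the secant pair `(s, y)`: among the symmetric `T` with
`T s = y` it minimizes the Frobenius distance to `B`. -/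
def IsPSBUpdate {n : ℕ} (B : Op n) (s y : E n) (B' : Op n) : Prop :=
  B' ∈ {T : Op n | IsSelfAdjoint T ∧ T s = y} ∧
  IsMinOn (fun T : Op n => frobNorm (T - B)) {T : Op n | IsSelfAdjoint T ∧ T s = y} B'

/-- The sequences produced by the method: iterates, steps, regularization parameters, and Hessian
approximations. -/
structure Sequences (n : ℕ) where
  x : ℕ → E n
  s : ℕ → E n
  σ : ℕ → ℝ
  B : ℕ → Op n

/-- The length of the step of index `j`, with the convention that it is `1` for `j < 0`. -/
def stepLen {n : ℕ} (R : Sequences n) (j : ℤ) : ℝ := if 0 ≤ j then ‖R.s j.toNat‖ else 1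

/-- The finite-difference stepsize `h_k`. -/
def fdStep {n : ℕ} (m : ℕ) (R : Sequences n) (k : ℕ) : ℝ :=
  min (∑ i ∈ Finset.Icc 1 m, stepLen R ((k : ℤ) - (i : ℤ))) 1 / Real.sqrt n

/-- The finite-difference operator `∑ᵢ ((∇f(x + h eᵢ) - ∇f(x)) / h) ⊗ eᵢ`. -/
def fdHess {n : ℕ} (f : E n → ℝ) (x : E n) (h : ℝ) : Op n :=
  ∑ i : Fin n, (innerSL ℝ (basisVec i)).smulRight
    (h⁻¹ • (gradient f (x + h • basisVec i) - gradient f x))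

/-- `B_k` is obtained from `B_{k-1}` by the PSB update along the last step. -/
def PSBAt {n : ℕ} (f : E n → ℝ) (R : Sequences n) (k : ℕ) : Prop :=
  IsPSBUpdate (R.B (k - 1)) (R.s (k - 1))
    (gradient f (R.x k) - gradient f (R.x (k - 1))) (R.B k)

/-- The choice of `B_k` with exact restarts: the true Hessian if `m ∣ k`, the PSB update if not. -/
def LazyTensor {n : ℕ} (f : E n → ℝ) (m : ℕ) (R : Sequences n) (k : ℕ) : Prop :=
  if k % m = 0 then R.B k = hess f (R.x k) else PSBAt f R k

/-- The choice of `B_k` with finite-difference restarts. Positivity of `h_k` says that the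
difference quotients are defined. -/
def FDTensor {n : ℕ} (f : E n → ℝ) (m : ℕ) (R : Sequences n) (k : ℕ) : Prop :=
  if k % m = 0 then
    0 < fdStep m R k ∧ R.B k = symPart (fdHess f (R.x k) (fdStep m R k))
  else PSBAt f R k

/-- The part of iteration `k` after the computation of `B_k`: an acceptable step is computed,
and the iterate and the regularization parameter are updated. -/
def Advances {n : ℕ} (f : E n → ℝ) (θ₁ θ₂ : ℝ) (R : Sequences n) (k : ℕ) : Prop :=
  IsAcceptableStep f θ₁ θ₂ (R.x k) (R.B k) (R.σ k) (R.s k) ∧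
  R.x (k + 1) = R.x k + R.s k ∧
  R.σ (k + 1) = R.σ k + R.σ k * ‖R.s k‖ ^ 3

/-- `R` is a run of the method, with `tensor k` the rule for `B_k`, from `x₀` and `σ₀`: iterations
are carried out for as long as no `(ε₁, ε₂)` stationary iterate has been met. Nothing is required
of `R` after that, so that never-ending runs are covered, and so are runs that cannot continue
once such a point is found. -/
def IsRun {n : ℕ} (f : E n → ℝ) (θ₁ θ₂ σ₀ : ℝ) (x₀ : E n) (ε₁ ε₂ : ℝ) (R : Sequences n)
    (tensor : ℕ → Prop) : Prop :=
  R.x 0 = x₀ ∧ R.σ 0 = σ₀ ∧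
  ∀ k : ℕ, (∀ j ≤ k, ¬ IsStationary f ε₁ ε₂ (R.x j)) → tensor k ∧ Advances f θ₁ θ₂ R k

/-- Run of the variant with exact Hessian restarts. -/
def IsLazyRun {n : ℕ} (f : E n → ℝ) (m : ℕ) (θ₁ θ₂ σ₀ : ℝ) (x₀ : E n) (ε₁ ε₂ : ℝ)
    (R : Sequences n) : Prop :=
  IsRun f θ₁ θ₂ σ₀ x₀ ε₁ ε₂ R (LazyTensor f m R)

/-- Run of the variant with finite-difference restarts. -/
def IsFDRun {n : ℕ} (f : E n → ℝ) (m : ℕ) (θ₁ θ₂ σ₀ : ℝ) (x₀ : E n) (ε₁ ε₂ : ℝ)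
    (R : Sequences n) : Prop :=
  IsRun f θ₁ θ₂ σ₀ x₀ ε₁ ε₂ R (FDTensor f m R)

/-- The points at which iteration `k` evaluates the gradient, with exact restarts (the secant
condition reuses the gradient of the previous iteration). -/
def lazyGradQueries {n : ℕ} (R : Sequences n) (k : ℕ) : List (E n) := [R.x k]

/-- The points at which iteration `k` evaluates the Hessian, with exact restarts. -/
def lazyHessQueries {n : ℕ} (m : ℕ) (R : Sequences n) (k : ℕ) : List (E n) :=
  if k % m = 0 then [R.x k] else []

/-- The points at which iteration `k` evaluates the gradient, with finite-difference restarts. -/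
def fdGradQueries {n : ℕ} (m : ℕ) (R : Sequences n) (k : ℕ) : List (E n) :=
  R.x k :: (if k % m = 0 then List.ofFn (fun i : Fin n => R.x k + fdStep m R k • basisVec i)
    else [])

/-- The total number of evaluations in iterations `0, …, j`. -/
def evalCount {n : ℕ} (queries : ℕ → List (E n)) (j : ℕ) : ℕ :=
  ∑ k ∈ Finset.range (j + 1), (queries k).length

end AR2PSB

end

namespace AR2PSB

/-! ### The Frobenius norm and the PSB update -/

lemma frobNorm_sq {n : ℕ} (A : Op n) :
    frobNorm A ^ 2 = ∑ j, ‖A (basisVec j)‖ ^ 2 := by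
  rw [frobNorm, Real.sq_sqrt (Finset.sum_nonneg fun i _ => Finset.sum_nonneg fun j _ => sq_nonneg _),
    Finset.sum_comm]
  refine Finset.sum_congr rfl fun j _ => ?_
  rw [← (EuclideanSpace.basisFun (Fin n) ℝ).sum_sq_norm_inner_right (A (basisVec j))]
  simp [basisVec]

lemma frobNorm_add_sq {n : ℕ} (Z M : Op n) (hZ : IsSelfAdjoint Z) :
    frobNorm (Z + M) ^ 2 =
      frobNorm Z ^ 2 + 2 * LinearMap.trace ℝ (E n) (Z * M : Op n) + frobNorm M ^ 2 := by
  rw [LinearMap.trace_eq_sum_inner _ (EuclideanSpace.basisFun (Fin n) ℝ)]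
  simp only [frobNorm_sq, Finset.mul_sum, ← Finset.sum_add_distrib]
  refine Finset.sum_congr rfl fun j _ => ?_
  have h := (ContinuousLinearMap.isSelfAdjoint_iff_isSymmetric.1 hZ) (basisVec j) (M (basisVec j))
  simp only [ContinuousLinearMap.coe_coe] at h
  rw [add_apply, norm_add_sq_real, h]
  simp [basisVec]

lemma eq_zero_of_frobNorm_sq_nonpos {n : ℕ} {A : Op n} (h : frobNorm A ^ 2 ≤ 0) : A = 0 := by
  rw [frobNorm_sq] at h
  have h0 := (Finset.sum_eq_zero_iff_of_nonneg fun j _ => sq_nonneg ‖A (basisVec j)‖).1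
    (le_antisymm h (Finset.sum_nonneg fun j _ => sq_nonneg _))
  have h1 : (A : E n →ₗ[ℝ] E n) = 0 := by
    refine (EuclideanSpace.basisFun (Fin n) ℝ).toBasis.ext fun j => ?_
    simpa [basisVec] using h0 j (Finset.mem_univ _)
  ext1 x
  exact LinearMap.congr_fun h1 x

lemma isSelfAdjoint_add {n : ℕ} {A B : Op n} (hA : IsSelfAdjoint A) (hB : IsSelfAdjoint B) :
    IsSelfAdjoint (A + B) := by
  rw [ContinuousLinearMap.isSelfAdjoint_iff'] at *
  rw [map_add, hA, hB]

lemma isSelfAdjoint_sub {n : ℕ} {A B : Op n} (hA : IsSelfAdjoint A) (hB : IsSelfAdjoint B) :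
    IsSelfAdjoint (A - B) := by
  rw [ContinuousLinearMap.isSelfAdjoint_iff'] at *
  rw [map_sub, hA, hB]

lemma mul_compress_sub_self {R : Type*} [Ring R] {Z P D : R} (h : Z * P = 0) :
    Z * ((1 - P) * D * (1 - P) - D) = -(Z * D * P) := by
  have : Z * ((1 - P) * D * (1 - P) - D) = Z * P * D * P - Z * P * D - Z * D * P := by noncomm_ring
  simp [this, h]

/-- For a symmetric `H` that satisfies the secant condition, the error of the PSB update is the
two-sided projection of the previous error. -/
lemma IsPSBUpdate.sub_eq {n : ℕ} {B B' H : Op n} {s y : E n} (h : IsPSBUpdate B s y B')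
    (hB : IsSelfAdjoint B) (hH : IsSelfAdjoint H) (hs : H s = y) :
    B' - H = (1 - (ℝ ∙ s).starProjection) * (B - H) * (1 - (ℝ ∙ s).starProjection) := by
  obtain ⟨⟨hB', hB's⟩, hmin⟩ := h
  set P : Op n := (ℝ ∙ s).starProjection with hP
  have hPs : P s = s := Submodule.starProjection_eq_self_iff.2 (Submodule.mem_span_singleton_self s)
  have hPsa : IsSelfAdjoint P := isSelfAdjoint_starProjection _
  set D : Op n := B - H with hD
  set T : Op n := H + (1 - P) * D * (1 - P) with hT
  have hQ : IsSelfAdjoint (1 - P) := by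
    rw [hP, ← Submodule.starProjection_orthogonal']
    exact isSelfAdjoint_starProjection _
  have hTsa : IsSelfAdjoint T := by
    refine isSelfAdjoint_add hH ?_
    have := (isSelfAdjoint_sub hB hH).conjugate_self hQ
    simpa [hD, mul_assoc] using this
  have hTs : T s = y := by simp [hT, hPs, hs]
  have hZsa : IsSelfAdjoint (B' - T) := isSelfAdjoint_sub hB' hTsa
  have hZs : (B' - T) s = 0 := by simp [hB's, hTs]
  have hZP : (B' - T) * P = 0 := by
    ext1 v
    obtain ⟨c, hc⟩ := Submodule.mem_span_singleton.1 ((ℝ ∙ s).starProjection_apply_mem v)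
    rw [mul_apply_eq_comp, hP, ← hc, map_smul, hZs]
    simp
  have hPZ : P * (B' - T) = 0 := by
    have h : P * (B' - T) = star 0 := by
      simpa [hZsa.star_eq, hPsa.star_eq] using congrArg star hZP
    exact h.trans (map_zero ContinuousLinearMap.adjoint)
  have htr : LinearMap.trace ℝ (E n) ((B' - T) * (T - B) : Op n) = 0 := by
    have h1 : (B' - T) * (T - B) = -((B' - T) * D * P) := by
      have e : T - B = (1 - P) * D * (1 - P) - D := by rw [hT, hD]; abel
      rw [e]
      exact mul_compress_sub_self hZP
    have h2 : LinearMap.trace ℝ (E n) ((B' - T) * D * P : Op n) = 0 := by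
      have := LinearMap.trace_mul_comm ℝ (((B' - T) * D : Op n) : E n →ₗ[ℝ] E n) (P : E n →ₗ[ℝ] E n)
      rw [← ContinuousLinearMap.toLinearMap_mul, ← ContinuousLinearMap.toLinearMap_mul,
        ← mul_assoc, hPZ] at this
      simpa using this
    rw [h1, ContinuousLinearMap.toLinearMap_neg, map_neg, h2, neg_zero]
  have hle : frobNorm (B' - B) ≤ frobNorm (T - B) := hmin ⟨hTsa, hTs⟩
  have hadd := frobNorm_add_sq (B' - T) (T - B) hZsa
  rw [sub_add_sub_cancel, htr] at hadd
  have hsq : frobNorm (B' - B) ^ 2 ≤ frobNorm (T - B) ^ 2 :=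
    pow_le_pow_left₀ (Real.sqrt_nonneg _) hle 2
  have := eq_zero_of_frobNorm_sq_nonpos (A := B' - T) (by linarith)
  rw [sub_eq_zero.1 this, hT]
  abel

lemma IsPSBUpdate.norm_sub_le {n : ℕ} {B B' H : Op n} {s y : E n} (h : IsPSBUpdate B s y B')
    (hB : IsSelfAdjoint B) (hH : IsSelfAdjoint H) (hs : H s = y) :
    ‖B' - H‖ ≤ ‖B - H‖ := by
  have hQ : ‖(1 - (ℝ ∙ s).starProjection : Op n)‖ ≤ 1 := by
    rw [← Submodule.starProjection_orthogonal']
    exact Submodule.starProjection_norm_le _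
  rw [h.sub_eq hB hH hs]
  calc _ ≤ ‖(1 - (ℝ ∙ s).starProjection : Op n) * (B - H)‖ * 1 :=
        (norm_mul_le _ _).trans (by gcongr)
    _ ≤ 1 * ‖B - H‖ := by
        rw [mul_one]
        exact (norm_mul_le _ _).trans (by gcongr)
    _ = _ := one_mul _

/-! ### The leftmost eigenvalue -/

lemma lambdaMin_mul_sq_le {n : ℕ} {A : Op n} (hA : IsSelfAdjoint A) (u : E n) :
    lambdaMin A * ‖u‖ ^ 2 ≤ inner ℝ u (A u) := by
  rcases eq_or_ne u 0 with rfl | hu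
  · simp
  have : Nontrivial (E n) := ⟨u, 0, hu⟩
  have hsym := ContinuousLinearMap.isSelfAdjoint_iff_isSymmetric.1 hA
  have hray : ∀ v : E n, -‖A‖ ≤ inner ℝ (A v) v / ‖v‖ ^ 2 := fun v =>
    (abs_le.1 (A.rayleighQuotient_le_norm v)).1
  have hmem := hsym.hasEigenvalue_iInf_of_finiteDimensional
  have h1 : lambdaMin A ≤ ⨅ x : {x : E n // x ≠ 0}, inner ℝ (A x) (x : E n) / ‖(x : E n)‖ ^ 2 := by
    refine csInf_le ⟨-‖A‖, ?_⟩ (by simpa using hmem)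
    rintro μ hμ
    obtain ⟨v, hv⟩ := Module.End.HasEigenvalue.exists_hasEigenvector hμ
    have h2 := hray v
    have h3 : A v = μ • v := hv.apply_eq_smul
    have h4 : ‖v‖ ≠ 0 := norm_ne_zero_iff.2 hv.2
    rw [h3, real_inner_smul_left, real_inner_self_eq_norm_sq, mul_div_assoc,
      div_self (pow_ne_zero 2 h4), mul_one] at h2
    exact h2
  have h2 : (⨅ x : {x : E n // x ≠ 0}, inner ℝ (A x) (x : E n) / ‖(x : E n)‖ ^ 2) ≤
      inner ℝ (A u) u / ‖u‖ ^ 2 :=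
    ciInf_le (f := fun x : {x : E n // x ≠ 0} => inner ℝ (A x) (x : E n) / ‖(x : E n)‖ ^ 2)
      ⟨-‖A‖, by rintro _ ⟨v, rfl⟩; exact hray v⟩ ⟨u, hu⟩
  have h3 : 0 < ‖u‖ ^ 2 := by positivity
  rw [real_inner_comm]
  exact (le_div_iff₀ h3).1 (h1.trans h2)

lemma le_lambdaMin {n : ℕ} {A : Op n} {c : ℝ} (hc : c ≤ 0)
    (h : ∀ u : E n, c * ‖u‖ ^ 2 ≤ inner ℝ u (A u)) : c ≤ lambdaMin A := by
  refine Real.le_sInf (fun μ hμ => ?_) hc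
  obtain ⟨v, hv⟩ := Module.End.HasEigenvalue.exists_hasEigenvector hμ
  have h3 : A v = μ • v := hv.apply_eq_smul
  have h1 := h v
  rw [h3, real_inner_smul_right, real_inner_self_eq_norm_sq] at h1
  have h4 : 0 < ‖v‖ ^ 2 := pow_pos (norm_pos_iff.2 hv.2) 2
  exact le_of_mul_le_mul_right h1 h4

lemma abs_inner_apply_le {n : ℕ} (A : Op n) (u : E n) : |inner ℝ u (A u)| ≤ ‖A‖ * ‖u‖ ^ 2 := by
  calc _ ≤ ‖u‖ * ‖A u‖ := abs_real_inner_le_norm _ _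
    _ ≤ ‖u‖ * (‖A‖ * ‖u‖) := by gcongr; exact A.le_opNorm u
    _ = _ := by ring


/-! ### Functions with a Lipschitz Hessian -/

section Calculus

variable {n : ℕ} {f : E n → ℝ}

lemma hasGradientAt_of_contDiff (hf : ContDiff ℝ 2 f) (x : E n) :
    HasGradientAt f (gradient f x) x :=
  (hf.differentiable (by norm_num) x).hasGradientAt

lemma contDiff_gradient (hf : ContDiff ℝ 2 f) : ContDiff ℝ 1 (gradient f) := by
  have h : ContDiff ℝ 1 (fderiv ℝ f) := hf.fderiv_right (by norm_num)
  exact ((InnerProductSpace.toDual ℝ (E n)).symm.toContinuousLinearEquiv.contDiff).comp h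

lemma hasFDerivAt_gradient (hf : ContDiff ℝ 2 f) (x : E n) :
    HasFDerivAt (gradient f) (hess f x) x :=
  ((contDiff_gradient hf).differentiable (by norm_num) x).hasFDerivAt

lemma inner_hess_apply (hf : ContDiff ℝ 2 f) (x u v : E n) :
    inner ℝ (hess f x u) v = fderiv ℝ (fderiv ℝ f) x u v := by
  have h1 : (fun y => inner ℝ (gradient f y) v) = fun y => fderiv ℝ f y v := by
    ext1 y; exact inner_gradient_left
  have h2 := (hasFDerivAt_gradient hf x).inner ℝ (hasFDerivAt_const v x)
  have h3 := ((hf.fderiv_right (m := 1) (by norm_num)).differentiable (by norm_num) x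
    ).hasFDerivAt.clm_apply (hasFDerivAt_const v x)
  rw [h1] at h2
  simpa using congrArg (fun T : E n →L[ℝ] ℝ => T u) (h2.unique h3)

lemma isSelfAdjoint_hess (hf : ContDiff ℝ 2 f) (x : E n) : IsSelfAdjoint (hess f x) := by
  rw [ContinuousLinearMap.isSelfAdjoint_iff_isSymmetric]
  intro u v
  have hs : IsSymmSndFDerivAt ℝ f x := hf.contDiffAt.isSymmSndFDerivAt (by simp)
  simp only [ContinuousLinearMap.coe_coe]
  rw [inner_hess_apply hf, real_inner_comm, inner_hess_apply hf]
  exact hs u v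

/-- The Hessian averaged over the segment from `x` to `x + s`. -/
noncomputable def avgHess (f : E n → ℝ) (x s : E n) : Op n := ∫ t in (0 : ℝ)..1, hess f (x + t • s)

variable {L : ℝ≥0}

lemma continuous_hess_segment (hL : LipschitzWith L (hess f)) (x s : E n) :
    Continuous fun t : ℝ => hess f (x + t • s) :=
  hL.continuous.comp (by fun_prop)

lemma avgHess_apply (hL : LipschitzWith L (hess f)) (x s v : E n) :
    avgHess f x s v = ∫ t in (0 : ℝ)..1, hess f (x + t • s) v :=
  ContinuousLinearMap.intervalIntegral_apply
    ((continuous_hess_segment hL x s).intervalIntegrable _ _) v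

lemma avgHess_apply_self (hf : ContDiff ℝ 2 f) (hL : LipschitzWith L (hess f)) (x s : E n) :
    avgHess f x s s = gradient f (x + s) - gradient f x := by
  rw [avgHess_apply hL]
  have hd : ∀ t ∈ Set.uIcc (0 : ℝ) 1,
      HasDerivAt (fun t : ℝ => gradient f (x + t • s)) (hess f (x + t • s) s) t := by
    intro t _
    have h1 : HasDerivAt (fun t : ℝ => x + t • s) s t := by
      simpa using ((hasDerivAt_id t).smul_const s).const_add x
    exact (hasFDerivAt_gradient hf (x + t • s)).comp_hasDerivAt t h1
  rw [intervalIntegral.integral_eq_sub_of_hasDerivAt hd]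
  · simp
  · exact ((continuous_hess_segment hL x s).clm_apply continuous_const).intervalIntegrable _ _

lemma isSelfAdjoint_avgHess (hf : ContDiff ℝ 2 f) (hL : LipschitzWith L (hess f)) (x s : E n) :
    IsSelfAdjoint (avgHess f x s) := by
  rw [ContinuousLinearMap.isSelfAdjoint_iff_isSymmetric]
  intro u v
  have key : ∀ a b : E n, inner ℝ a (avgHess f x s b) =
      ∫ t in (0 : ℝ)..1, inner ℝ a (hess f (x + t • s) b) := by
    intro a b
    rw [avgHess_apply hL]
    exact ((innerSL ℝ a).intervalIntegral_comp_comm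
      (((continuous_hess_segment hL x s).clm_apply continuous_const).intervalIntegrable _ _)).symm
  simp only [ContinuousLinearMap.coe_coe]
  rw [real_inner_comm, key, key]
  refine intervalIntegral.integral_congr fun t _ => ?_
  have := (ContinuousLinearMap.isSelfAdjoint_iff_isSymmetric.1
    (isSelfAdjoint_hess hf (x + t • s))) u v
  simp only [ContinuousLinearMap.coe_coe] at this
  rw [← this, real_inner_comm]

lemma norm_avgHess_sub_le (hL : LipschitzWith L (hess f)) (x s : E n) {A : Op n} {c : ℝ}
    (h : ∀ t ∈ Set.Icc (0 : ℝ) 1, ‖hess f (x + t • s) - A‖ ≤ c) : ‖avgHess f x s - A‖ ≤ c := by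
  have h1 : avgHess f x s - A = ∫ t in (0 : ℝ)..1, (hess f (x + t • s) - A) := by
    rw [intervalIntegral.integral_sub ((continuous_hess_segment hL x s).intervalIntegrable _ _)
      (continuous_const.intervalIntegrable _ _)]
    simp [avgHess]
  rw [h1]
  simpa using intervalIntegral.norm_integral_le_of_norm_le_const (a := (0 : ℝ)) (b := 1) (C := c)
    (fun t ht => by
      rw [Set.uIoc_of_le zero_le_one] at ht
      exact h t ⟨ht.1.le, ht.2⟩)

lemma norm_hess_segment_sub_left_le (hL : LipschitzWith L (hess f)) (x s : E n) {t : ℝ}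
    (ht : t ∈ Set.Icc (0 : ℝ) 1) : ‖hess f (x + t • s) - hess f x‖ ≤ L * ‖s‖ := by
  refine (hL.norm_sub_le _ _).trans ?_
  rw [add_sub_cancel_left, norm_smul, Real.norm_of_nonneg ht.1]
  gcongr
  exact mul_le_of_le_one_left (norm_nonneg _) ht.2

lemma norm_avgHess_sub_left_le (hL : LipschitzWith L (hess f)) (x s : E n) :
    ‖avgHess f x s - hess f x‖ ≤ L * ‖s‖ :=
  norm_avgHess_sub_le hL x s fun _ ht => norm_hess_segment_sub_left_le hL x s ht

lemma norm_avgHess_sub_right_le (hL : LipschitzWith L (hess f)) (x s : E n) :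
    ‖avgHess f x s - hess f (x + s)‖ ≤ L * ‖s‖ := by
  refine norm_avgHess_sub_le hL x s fun t ht => ?_
  refine (hL.norm_sub_le _ _).trans ?_
  have : x + t • s - (x + s) = (t - 1) • s := by rw [sub_smul, one_smul]; abel
  rw [this, norm_smul, Real.norm_eq_abs, abs_of_nonpos (by linarith [ht.2])]
  gcongr
  exact mul_le_of_le_one_left (norm_nonneg _) (by linarith [ht.1])

lemma norm_gradient_add_sub_le (hf : ContDiff ℝ 2 f) (hL : LipschitzWith L (hess f)) (x s : E n) :
    ‖gradient f (x + s) - gradient f x - hess f x s‖ ≤ L * ‖s‖ ^ 2 := by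
  rw [← avgHess_apply_self hf hL, ← sub_apply]
  calc _ ≤ ‖avgHess f x s - hess f x‖ * ‖s‖ := ContinuousLinearMap.le_opNorm _ _
    _ ≤ L * ‖s‖ * ‖s‖ := by gcongr; exact norm_avgHess_sub_left_le hL x s
    _ = _ := by ring

lemma apply_add_le (hf : ContDiff ℝ 2 f) (hL : LipschitzWith L (hess f)) (x s : E n) :
    f (x + s) ≤ f x + inner ℝ (gradient f x) s + 1 / 2 * inner ℝ s (hess f x s) + L * ‖s‖ ^ 3 := by
  set φ : ℝ → ℝ := fun t => f (x + t • s) - t * inner ℝ (gradient f x) s -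
    t ^ 2 * (1 / 2 * inner ℝ s (hess f x s)) with hφ
  have hd : ∀ t : ℝ, HasDerivAt φ
      (inner ℝ (gradient f (x + t • s) - gradient f x - hess f x (t • s)) s) t := by
    intro t
    have h1 : HasDerivAt (fun t : ℝ => x + t • s) s t := by
      simpa using ((hasDerivAt_id t).smul_const s).const_add x
    have h2 := (hasGradientAt_of_contDiff hf (x + t • s)).hasFDerivAt.comp_hasDerivAt t h1
    have h3 := (h2.sub ((hasDerivAt_id t).mul_const (inner ℝ (gradient f x) s))).sub
      ((hasDerivAt_pow 2 t).mul_const (1 / 2 * inner ℝ s (hess f x s)))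
    refine h3.congr_deriv ?_
    rw [inner_sub_left, inner_sub_left, map_smul, real_inner_smul_left,
      real_inner_comm (hess f x s) s]
    simp
    ring
  have hb := norm_image_sub_le_of_norm_deriv_le_segment_01' (f := φ) (C := L * ‖s‖ ^ 3)
    (fun t _ => (hd t).hasDerivWithinAt) (fun t ht => by
      have h1 := norm_gradient_add_sub_le hf hL x (t • s)
      calc _ ≤ ‖gradient f (x + t • s) - gradient f x - hess f x (t • s)‖ * ‖s‖ :=
            norm_inner_le_norm _ _
        _ ≤ L * ‖t • s‖ ^ 2 * ‖s‖ := by gcongr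
        _ ≤ L * ‖s‖ ^ 2 * ‖s‖ := by
            gcongr
            rw [norm_smul, Real.norm_of_nonneg ht.1]
            exact mul_le_of_le_one_left (norm_nonneg _) ht.2.le
        _ = _ := by ring)
  have := (Real.norm_eq_abs _ ▸ le_abs_self (φ 1 - φ 0)).trans hb
  simp only [hφ, one_smul, zero_smul, add_zero] at this
  linarith

end Calculus

/-! ### The finite-difference operator -/

lemma norm_symPart_sub_le {n : ℕ} (A : Op n) {H : Op n} (hH : IsSelfAdjoint H) :
    ‖symPart A - H‖ ≤ ‖A - H‖ := by
  have h1 : symPart A - H = (1 / 2 : ℝ) • ((A - H) + ContinuousLinearMap.adjoint (A - H)) := by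
    have h2 : ContinuousLinearMap.adjoint H = H := hH
    rw [symPart, map_sub, h2]
    module
  rw [h1, norm_smul]
  have h3 := norm_add_le (A - H) (ContinuousLinearMap.adjoint (A - H))
  rw [LinearIsometryEquiv.norm_map] at h3
  rw [Real.norm_of_nonneg (by norm_num)]
  linarith

lemma isSelfAdjoint_symPart {n : ℕ} (A : Op n) : IsSelfAdjoint (symPart A) := by
  rw [ContinuousLinearMap.isSelfAdjoint_iff', symPart, map_smulₛₗ, map_add,
    ContinuousLinearMap.adjoint_adjoint, add_comm]
  simp

lemma norm_fdHess_sub_hess_le {n : ℕ} {f : E n → ℝ} {L : ℝ≥0} (hf : ContDiff ℝ 2 f)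
    (hL : LipschitzWith L (hess f)) (x : E n) {h : ℝ} (hh : 0 < h) :
    ‖fdHess f x h - hess f x‖ ≤ L * (h * Real.sqrt n) := by
  have hcol : ∀ i : Fin n,
      ‖h⁻¹ • (gradient f (x + h • basisVec i) - gradient f x) - hess f x (basisVec i)‖ ≤ L * h := by
    intro i
    have h1 := norm_gradient_add_sub_le hf hL x (h • basisVec i)
    have h2 : h⁻¹ • (gradient f (x + h • basisVec i) - gradient f x) - hess f x (basisVec i) =
        h⁻¹ • (gradient f (x + h • basisVec i) - gradient f x - hess f x (h • basisVec i)) := by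
      rw [smul_sub _ _ (hess f x (h • basisVec i)), map_smul, smul_smul, inv_mul_cancel₀ hh.ne',
        one_smul]
    have h3 : ‖h • (basisVec i : E n)‖ = h := by
      simp [norm_smul, basisVec, abs_of_pos hh]
    rw [h3] at h1
    rw [h2, norm_smul, norm_inv, Real.norm_of_nonneg hh.le]
    calc _ ≤ h⁻¹ * (L * h ^ 2) := by gcongr
      _ = _ := by field_simp
  refine ContinuousLinearMap.opNorm_le_bound _ (by positivity) fun v => ?_
  have hv : (fdHess f x h - hess f x) v = ∑ i, v i •
      (h⁻¹ • (gradient f (x + h • basisVec i) - gradient f x) - hess f x (basisVec i)) := by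
    have h1 : hess f x v = ∑ i, v i • hess f x (basisVec i) := by
      conv_lhs => rw [← (EuclideanSpace.basisFun (Fin n) ℝ).sum_repr v]
      simp [basisVec]
    simp only [smul_sub _ _ (hess f x _), Finset.sum_sub_distrib, ← h1]
    simp [fdHess, basisVec, EuclideanSpace.inner_single_left]
  rw [hv]
  have hcs : (∑ i, |v i|) ≤ Real.sqrt n * ‖v‖ := by
    have := Real.sum_mul_le_sqrt_mul_sqrt Finset.univ (fun _ : Fin n => (1 : ℝ)) (fun i => |v i|)
    simpa [EuclideanSpace.norm_eq] using this
  calc _ ≤ ∑ i, |v i| * (L * h) := by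
        refine (norm_sum_le _ _).trans (Finset.sum_le_sum fun i _ => ?_)
        rw [norm_smul, Real.norm_eq_abs]
        gcongr
        exact hcol i
    _ = (∑ i, |v i|) * (L * h) := by rw [Finset.sum_mul]
    _ ≤ Real.sqrt n * ‖v‖ * (L * h) := by gcongr
    _ = _ := by ring


/-! ### Scalar recursions -/

/-- The sum of the `M` terms of `a` that precede index `k`. -/
def window (a : ℤ → ℝ) (M k : ℕ) : ℝ := ∑ i ∈ Finset.Icc 1 M, a ((k : ℤ) - (i : ℤ))

lemma sum_shift_le {b : ℤ → ℝ} (hb : ∀ j, 0 ≤ b j) (hneg : ∀ j < 0, b j = 1) (N i : ℕ) :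
    ∑ k ∈ Finset.range N, b ((k : ℤ) - (i : ℤ)) ≤ i + ∑ k ∈ Finset.range N, b k := by
  induction i with
  | zero => simp
  | succ i ih =>
    cases N with
    | zero => simp; positivity
    | succ N =>
      rw [Finset.sum_range_succ']
      rw [Finset.sum_range_succ] at ih
      have h1 : ∀ k : ℕ, (((k + 1 : ℕ) : ℤ) - ((i + 1 : ℕ) : ℤ)) = (k : ℤ) - (i : ℤ) := by
        intro k; push_cast; ring
      simp only [h1]
      rw [hneg (((0 : ℕ) : ℤ) - ((i + 1 : ℕ) : ℤ)) (by push_cast; omega)]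
      push_cast
      linarith [hb ((N : ℤ) - (i : ℤ))]

lemma window_nonneg {a : ℤ → ℝ} (ha : ∀ j, 0 ≤ a j) (M k : ℕ) : 0 ≤ window a M k :=
  Finset.sum_nonneg fun _ _ => ha _

lemma sum_window_cube_le {a : ℤ → ℝ} (ha : ∀ j, 0 ≤ a j) (hneg : ∀ j < 0, a j = 1) (M N : ℕ) :
    ∑ k ∈ Finset.range N, window a M k ^ 3 ≤
      (M : ℝ) ^ 3 * (M + ∑ k ∈ Finset.range N, a k ^ 3) := by
  calc ∑ k ∈ Finset.range N, window a M k ^ 3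
      ≤ ∑ k ∈ Finset.range N,
          (M : ℝ) ^ 2 * ∑ i ∈ Finset.Icc 1 M, a ((k : ℤ) - (i : ℤ)) ^ 3 := by
        refine Finset.sum_le_sum fun k _ => ?_
        simpa [window] using pow_sum_le_card_mul_sum_pow (s := Finset.Icc 1 M)
          (fun i _ => ha ((k : ℤ) - (i : ℤ))) 2
    _ = (M : ℝ) ^ 2 * ∑ i ∈ Finset.Icc 1 M,
          ∑ k ∈ Finset.range N, a ((k : ℤ) - (i : ℤ)) ^ 3 := by
        rw [← Finset.mul_sum, Finset.sum_comm]
    _ ≤ (M : ℝ) ^ 2 * ∑ i ∈ Finset.Icc 1 M, (M + ∑ k ∈ Finset.range N, a k ^ 3) := by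
        gcongr with i hi
        refine (sum_shift_le (b := fun j => a j ^ 3) (fun j => pow_nonneg (ha j) 3)
          (fun j hj => by simp [hneg j hj]) N i).trans ?_
        gcongr
        exact (Finset.mem_Icc.1 hi).2
    _ = _ := by
        simp only [Finset.sum_const, Nat.card_Icc, nsmul_eq_mul, Nat.add_sub_cancel]
        ring

/-- The relations between step lengths `a`, regularization parameters `σ`, optimality gaps `φ`,
gradient norms `γ`, and Hessian errors `e` in the first `K` iterations. -/
structure StepBounds (L Δ G σ₀ θ₁ : ℝ) (M K : ℕ) (a : ℤ → ℝ) (σ φ γ e : ℕ → ℝ) : Prop where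
  len_nonneg : ∀ j, 0 ≤ a j
  len_neg : ∀ j < 0, a j = 1
  reg_zero : σ 0 = σ₀
  gap_zero : φ 0 ≤ Δ
  gap_nonneg : ∀ k, 0 ≤ φ k
  grad_zero : γ 0 ≤ G
  err_le : ∀ k < K, e k ≤ 2 * L * window a M k
  reg_succ : ∀ k < K, σ (k + 1) = σ k + σ k * a k ^ 3
  gap_succ : ∀ k < K, φ (k + 1) ≤ φ k - σ k / 6 * a k ^ 3 + L * a k ^ 3 + e k / 2 * a k ^ 2
  grad_succ : ∀ k < K, γ (k + 1) ≤ (θ₁ * σ k / 2 + L) * a k ^ 2 + e k * a k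
  len_le : ∀ k < K, 1 ≤ a k → σ k / 6 * a k ≤ 2 * γ k + φ k + L + e k / 2

namespace StepBounds

variable {L Δ G σ₀ θ₁ : ℝ} {M K : ℕ} {a : ℤ → ℝ} {σ φ γ e : ℕ → ℝ}

lemma le_reg (h : StepBounds L Δ G σ₀ θ₁ M K a σ φ γ e) (hσ₀ : 0 < σ₀) :
    ∀ k ≤ K, σ₀ ≤ σ k := by
  intro k
  induction k with
  | zero => intro _; exact h.reg_zero.ge
  | succ k ih =>
    intro hk
    have h1 := ih (by omega)
    rw [h.reg_succ k hk]
    have := mul_nonneg (hσ₀.le.trans h1) (pow_nonneg (h.len_nonneg k) 3)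
    linarith

lemma reg_mono (h : StepBounds L Δ G σ₀ θ₁ M K a σ φ γ e) (hσ₀ : 0 < σ₀) {i j : ℕ}
    (hij : i ≤ j) (hj : j ≤ K) : σ i ≤ σ j := by
  induction j, hij using Nat.le_induction with
  | base => exact le_rfl
  | succ j hij ih =>
    rw [h.reg_succ j hj]
    have := mul_nonneg (hσ₀.le.trans (h.le_reg hσ₀ j (by omega))) (pow_nonneg (h.len_nonneg j) 3)
    linarith [ih (by omega)]

lemma mul_sum_cube_le (h : StepBounds L Δ G σ₀ θ₁ M K a σ φ γ e) (hσ₀ : 0 < σ₀) :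
    ∀ N ≤ K, σ₀ * ∑ k ∈ Finset.range N, a k ^ 3 ≤ σ N - σ₀ := by
  intro N
  induction N with
  | zero => intro _; simp [h.reg_zero]
  | succ N ih =>
    intro hN
    rw [Finset.sum_range_succ, mul_add, h.reg_succ N hN]
    have := mul_le_mul_of_nonneg_right (h.le_reg hσ₀ N (by omega)) (pow_nonneg (h.len_nonneg N) 3)
    linarith [ih (by omega)]

lemma mul_sq_le_cube_add_cube {x y : ℝ} (hx : 0 ≤ x) (hy : 0 ≤ y) : x * y ^ 2 ≤ x ^ 3 + y ^ 3 := by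
  rcases le_total x y with hxy | hxy
  · have := mul_le_mul_of_nonneg_right hxy (sq_nonneg y)
    nlinarith [pow_nonneg hx 3]
  · have : y ^ 2 ≤ x ^ 2 := pow_le_pow_left₀ hy hxy 2
    nlinarith [mul_le_mul_of_nonneg_left this hx, pow_nonneg hy 3]

lemma gap_add_reg_le (h : StepBounds L Δ G σ₀ θ₁ M K a σ φ γ e) (hL : 0 ≤ L) {N : ℕ}
    (hN : N ≤ K) :
    φ N + (σ N - σ₀) / 6 ≤
      Δ + L * (M : ℝ) ^ 4 + (2 * L + L * (M : ℝ) ^ 3) * ∑ k ∈ Finset.range N, a k ^ 3 := by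
  have key : ∀ N ≤ K, φ N + (σ N - σ₀) / 6 ≤ Δ + 2 * L * ∑ k ∈ Finset.range N, a k ^ 3 +
      L * ∑ k ∈ Finset.range N, window a M k ^ 3 := by
    intro N
    induction N with
    | zero => intro _; simp [h.reg_zero, h.gap_zero]
    | succ N ih =>
      intro hN
      rw [Finset.sum_range_succ, Finset.sum_range_succ, h.reg_succ N hN]
      have h1 := mul_le_mul_of_nonneg_right (h.err_le N hN) (sq_nonneg (a N))
      have h2 := mul_le_mul_of_nonneg_left
        (mul_sq_le_cube_add_cube (window_nonneg h.len_nonneg M N) (h.len_nonneg N)) hL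
      linarith [ih (by omega), h.gap_succ N hN]
  have h1 := mul_le_mul_of_nonneg_left (sum_window_cube_le h.len_nonneg h.len_neg M N) hL
  linarith [key N hN]

lemma len_le_of_sum_cube_le (h : StepBounds L Δ G σ₀ θ₁ M K a σ φ γ e) {N : ℕ} {S : ℝ}
    (hS : ∑ k ∈ Finset.range N, a k ^ 3 ≤ S) {j : ℤ} (hj : j < N) : a j ≤ 1 + S := by
  have hS0 : 0 ≤ S :=
    (Finset.sum_nonneg (f := fun k : ℕ => a k ^ 3)
      fun k _ => pow_nonneg (h.len_nonneg k) 3).trans hS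
  rcases lt_or_ge j 0 with hj0 | hj0
  · rw [h.len_neg j hj0]; linarith
  · lift j to ℕ using hj0
    have h1 : a j ^ 3 ≤ S := (Finset.single_le_sum (f := fun k : ℕ => a k ^ 3)
      (fun k _ => pow_nonneg (h.len_nonneg k) 3)
      (Finset.mem_range.2 (by exact_mod_cast hj))).trans hS
    by_contra! hlt
    have h2 : (1 : ℝ) ≤ a j := by linarith
    have h3 : a j ≤ a j ^ 3 := le_self_pow₀ h2 (by norm_num)
    linarith

lemma window_le_of_sum_cube_le (h : StepBounds L Δ G σ₀ θ₁ M K a σ φ γ e) {N : ℕ} {S : ℝ}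
    (hS : ∑ k ∈ Finset.range N, a k ^ 3 ≤ S) {k : ℕ} (hk : k ≤ N) :
    window a M k ≤ M * (1 + S) := by
  refine (Finset.sum_le_card_nsmul _ _ (1 + S) fun i hi => ?_).trans (by simp [mul_add])
  have := Finset.mem_Icc.1 hi
  exact h.len_le_of_sum_cube_le hS (by omega)

end StepBounds

/-- While the regularization parameter is below a threshold, so is the next step length. -/
lemma exists_len_bound {L Δ G σ₀ θ₁ : ℝ} (M : ℕ) (τ : ℝ) (hL : 0 ≤ L) (hσ₀ : 0 < σ₀)
    (hθ₁ : 0 ≤ θ₁) (hτ : 0 ≤ τ) :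
    ∃ ρ : ℝ, 0 ≤ ρ ∧ ∀ (K : ℕ) (a : ℤ → ℝ) (σ φ γ e : ℕ → ℝ),
      StepBounds L Δ G σ₀ θ₁ M K a σ φ γ e → ∀ N < K, σ N ≤ τ → a N ≤ ρ := by
  set S : ℝ := τ / σ₀ with hS
  have hS0 : 0 ≤ S := by positivity
  set Eb : ℝ := 2 * L * (M * (1 + S)) with hEb
  set Γb : ℝ := |G| + ((θ₁ * τ / 2 + L) * (1 + S) ^ 2 + Eb * (1 + S)) with hΓb
  set Φb : ℝ := |Δ| + L * (M : ℝ) ^ 4 + (2 * L + L * (M : ℝ) ^ 3) * S with hΦb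
  have hEb0 : 0 ≤ Eb := by positivity
  have hΓb0 : 0 ≤ Γb := by positivity
  have hΦb0 : 0 ≤ Φb := by positivity
  refine ⟨1 + 6 / σ₀ * (2 * Γb + Φb + L + Eb / 2), by positivity, ?_⟩
  intro K a σ φ γ e h N hN hσN
  have hsum : ∑ k ∈ Finset.range N, a k ^ 3 ≤ S := by
    rw [hS, le_div_iff₀ hσ₀]
    linarith [h.mul_sum_cube_le hσ₀ N hN.le]
  have herr : ∀ k ≤ N, e k ≤ Eb := fun k hk =>
    (h.err_le k (by omega)).trans (by
      rw [hEb]; gcongr; exact h.window_le_of_sum_cube_le hsum hk)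
  have hφ : φ N ≤ Φb := by
    have h1 := h.gap_add_reg_le hL hN.le
    have h2 : (2 * L + L * (M : ℝ) ^ 3) * ∑ k ∈ Finset.range N, a k ^ 3 ≤
      (2 * L + L * (M : ℝ) ^ 3) * S := by gcongr
    linarith [h.le_reg hσ₀ N hN.le, le_abs_self Δ]
  have hγ : γ N ≤ Γb := by
    cases N with
    | zero =>
      have : 0 ≤ (θ₁ * τ / 2 + L) * (1 + S) ^ 2 + Eb * (1 + S) := by positivity
      linarith [h.grad_zero, le_abs_self G]
    | succ p =>
      have h1 : a p ≤ 1 + S := h.len_le_of_sum_cube_le hsum (by push_cast; omega)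
      have h0 := h.len_nonneg p
      have h2 : σ p ≤ τ := (h.reg_mono hσ₀ p.le_succ hN.le).trans hσN
      have h3 := h.grad_succ p (by omega)
      have h4 : (θ₁ * σ p / 2 + L) * a p ^ 2 ≤ (θ₁ * τ / 2 + L) * (1 + S) ^ 2 := by gcongr
      have h5 : e p * a p ≤ Eb * (1 + S) :=
        mul_le_mul (herr p p.le_succ) h1 h0 hEb0
      linarith [abs_nonneg G]
  have hX0 : 0 ≤ 6 / σ₀ * (2 * Γb + Φb + L + Eb / 2) := by positivity
  rcases le_total (a N) 1 with h1 | h1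
  · linarith
  · have h2 := h.len_le N hN h1
    have h3 : σ₀ / 6 * a N ≤ 2 * Γb + Φb + L + Eb / 2 := by
      have := mul_le_mul_of_nonneg_right (h.le_reg hσ₀ N hN.le) (h.len_nonneg N)
      linarith [herr N le_rfl]
    have h4 : a N ≤ 6 / σ₀ * (2 * Γb + Φb + L + Eb / 2) := by
      calc a N = 6 / σ₀ * (σ₀ / 6 * a N) := by field_simp
        _ ≤ _ := by gcongr
    linarith

/-- The regularization parameter stays bounded. -/
lemma exists_reg_bound {L Δ G σ₀ θ₁ : ℝ} (M : ℕ) (hL : 0 ≤ L) (hσ₀ : 0 < σ₀) (hθ₁ : 0 ≤ θ₁) :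
    ∃ T : ℝ, 0 ≤ T ∧ ∀ (K : ℕ) (a : ℤ → ℝ) (σ φ γ e : ℕ → ℝ),
      StepBounds L Δ G σ₀ θ₁ M K a σ φ γ e → ∀ N ≤ K, σ N ≤ T := by
  set c : ℝ := 2 * L + L * (M : ℝ) ^ 3 with hc
  have hc0 : 0 ≤ c := by positivity
  obtain ⟨ρ, hρ0, hρ⟩ := exists_len_bound (Δ := Δ) (G := G) M (12 * c) hL hσ₀ hθ₁ (by positivity)
  refine ⟨σ₀ + 12 * (|Δ| + L * (M : ℝ) ^ 4 + c * (12 * c / σ₀ + ρ ^ 3)), by positivity, ?_⟩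
  intro K a σ φ γ e h
  have key : ∀ N ≤ K, c * ∑ k ∈ Finset.range N, a k ^ 3 ≤
      (σ N - σ₀) / 12 + c * (12 * c / σ₀ + ρ ^ 3) := by
    intro N
    induction N with
    | zero => intro _; simp [h.reg_zero]; positivity
    | succ N ih =>
      intro hN
      rw [Finset.sum_range_succ]
      rcases le_total (σ N) (12 * c) with h1 | h1
      · have h2 : ∑ k ∈ Finset.range N, a k ^ 3 ≤ 12 * c / σ₀ := by
          rw [le_div_iff₀ hσ₀]
          linarith [h.mul_sum_cube_le hσ₀ N (by omega)]
        have h3 : a N ^ 3 ≤ ρ ^ 3 := pow_le_pow_left₀ (h.len_nonneg N) (hρ K a σ φ γ e h N hN h1) 3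
        have h4 : c * (∑ k ∈ Finset.range N, a k ^ 3 + a N ^ 3) ≤ c * (12 * c / σ₀ + ρ ^ 3) := by
          gcongr
        linarith [h.le_reg hσ₀ (N + 1) hN]
      · have h2 := mul_le_mul_of_nonneg_right h1 (pow_nonneg (h.len_nonneg N) 3)
        rw [h.reg_succ N hN]
        linarith [ih (by omega)]
  intro N hN
  have h1 := h.gap_add_reg_le hL hN
  linarith [key N hN, h.gap_nonneg N, le_abs_self Δ]

/-- If every iteration makes a step that is large compared with the tolerances, relative to the
preceding steps, then there are few iterations. -/
lemma exists_iteration_bound {L Δ G σ₀ θ₁ θ₂ : ℝ} (M : ℕ) (hL : 0 ≤ L) (hσ₀ : 0 < σ₀)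
    (hθ₁ : 0 ≤ θ₁) (hθ₂ : 0 ≤ θ₂) :
    ∃ C : ℝ, 0 ≤ C ∧ ∀ (K : ℕ) (a : ℤ → ℝ) (σ φ γ e : ℕ → ℝ),
      StepBounds L Δ G σ₀ θ₁ M K a σ φ γ e →
      ∀ ε₁ ε₂ : ℝ, 0 < ε₁ → 0 < ε₂ →
      (∀ k < K, ε₁ ≤ γ (k + 1) ∨ ε₂ ≤ (θ₂ * σ k + L) * a k + e k) →
      (K : ℝ) ≤ C * max (ε₁ ^ (-(3 / 2) : ℝ)) (ε₂ ^ (-3 : ℝ)) := by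
  obtain ⟨T, hT0, hT⟩ := exists_reg_bound (Δ := Δ) (G := G) M hL hσ₀ hθ₁
  set A : ℝ := θ₁ * T + θ₂ * T + 3 * L + 1 with hA
  have hA1 : 1 ≤ A := by
    have : 0 ≤ θ₁ * T + θ₂ * T + 3 * L := by positivity
    linarith
  have hA0 : 0 ≤ A := by linarith
  refine ⟨A ^ 3 * (4 * ((M : ℝ) ^ 3 * (M + T / σ₀) + T / σ₀)), by positivity, ?_⟩
  intro K a σ φ γ e h ε₁ ε₂ hε₁ hε₂ hlarge
  set X : ℝ := max (ε₁ ^ (-(3 / 2) : ℝ)) (ε₂ ^ (-3 : ℝ)) with hX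
  have hX0 : 0 ≤ X := le_max_of_le_left (by positivity)
  have hone : ∀ k < K, 1 ≤ X * (A * (window a M k + a k)) ^ 3 := by
    intro k hk
    have hw := window_nonneg h.len_nonneg M k
    have ha := h.len_nonneg k
    have hσk := hT K a σ φ γ e h k hk.le
    have hσ0 := hσ₀.le.trans (h.le_reg hσ₀ k hk.le)
    have he := h.err_le k hk
    have ht1 : θ₁ * σ k ≤ θ₁ * T := by gcongr
    have ht2 : θ₂ * σ k ≤ θ₂ * T := by gcongr
    have ht1' : 0 ≤ θ₁ * T := by positivity
    have ht2' : 0 ≤ θ₂ * T := by positivity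
    set v := window a M k + a k with hv
    have hv0 : 0 ≤ v := by positivity
    have haw : a k ≤ v := by linarith
    have hww : window a M k ≤ v := by linarith
    rcases hlarge k hk with h1 | h1
    · have h2 : γ (k + 1) ≤ (A * v) ^ 2 := by
        have h3 := h.grad_succ k hk
        have h4 : (θ₁ * σ k / 2 + L) * a k ^ 2 ≤ (θ₁ * T + L) * v ^ 2 := by
          gcongr
          linarith
        have h5 : e k * a k ≤ 2 * L * v * v := by
          refine mul_le_mul (he.trans (by gcongr)) haw ha (by positivity)
        have h6 : (θ₁ * T + 3 * L) * v ^ 2 ≤ A ^ 2 * v ^ 2 := by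
          gcongr
          nlinarith
        rw [mul_pow]
        linarith
      have h3 : ε₁ ^ (3 / 2 : ℝ) ≤ (A * v) ^ 3 := by
        have h4 : ε₁ ^ (3 / 2 : ℝ) ≤ ((A * v) ^ 2) ^ (3 / 2 : ℝ) :=
          Real.rpow_le_rpow hε₁.le (h1.trans h2) (by norm_num)
        rw [← Real.rpow_natCast, ← Real.rpow_mul (by positivity)] at h4
        norm_num at h4
        exact_mod_cast h4
      have h4 : ε₁ ^ (-(3 / 2) : ℝ) ≤ X := le_max_left _ _
      calc (1 : ℝ) = ε₁ ^ (-(3 / 2) : ℝ) * ε₁ ^ (3 / 2 : ℝ) := by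
            rw [← Real.rpow_add hε₁]; norm_num
        _ ≤ _ := by gcongr
    · have h2 : ε₂ ≤ A * v := by
        have h4 : (θ₂ * σ k + L) * a k ≤ (θ₂ * T + L) * v := by gcongr
        have h5 : e k ≤ 2 * L * v := he.trans (by gcongr)
        have h6 : (θ₂ * T + 3 * L) * v ≤ A * v := by
          gcongr
          linarith
        linarith
      have h3 : ε₂ ^ 3 ≤ (A * v) ^ 3 := pow_le_pow_left₀ hε₂.le h2 3
      have h4 : ε₂ ^ (-3 : ℝ) ≤ X := le_max_right _ _
      calc (1 : ℝ) = ε₂ ^ (-3 : ℝ) * ε₂ ^ 3 := by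
            rw [← Real.rpow_natCast, ← Real.rpow_add hε₂]; norm_num
        _ ≤ _ := by gcongr
  have hS : ∑ k ∈ Finset.range K, a k ^ 3 ≤ T / σ₀ := by
    rw [le_div_iff₀ hσ₀]
    linarith [h.mul_sum_cube_le hσ₀ K le_rfl, hT K a σ φ γ e h K le_rfl]
  have hW : ∑ k ∈ Finset.range K, window a M k ^ 3 ≤ (M : ℝ) ^ 3 * (M + T / σ₀) :=
    (sum_window_cube_le h.len_nonneg h.len_neg M K).trans (by gcongr)
  calc (K : ℝ) = ∑ k ∈ Finset.range K, (1 : ℝ) := by simp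
    _ ≤ ∑ k ∈ Finset.range K, X * (A ^ 3 * (4 * (window a M k ^ 3 + a k ^ 3))) := by
        refine Finset.sum_le_sum fun k hk => (hone k (Finset.mem_range.1 hk)).trans ?_
        rw [mul_pow]
        gcongr
        have hw := window_nonneg h.len_nonneg M k
        have ha := h.len_nonneg k
        nlinarith [mul_nonneg (add_nonneg hw ha) (sq_nonneg (window a M k - a k))]
    _ = X * (A ^ 3 * (4 * (∑ k ∈ Finset.range K, window a M k ^ 3 +
          ∑ k ∈ Finset.range K, a k ^ 3))) := by
        rw [← Finset.sum_add_distrib]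
        simp only [Finset.mul_sum]
    _ ≤ X * (A ^ 3 * (4 * ((M : ℝ) ^ 3 * (M + T / σ₀) + T / σ₀))) := by gcongr
    _ = _ := by ring


/-! ### One iteration of the method -/

section Iteration

variable {n : ℕ} {f : E n → ℝ} {L : ℝ≥0}

lemma hasGradientAt_approxTaylor (x : E n) {B : Op n} (hB : IsSelfAdjoint B) (s : E n) :
    HasGradientAt (approxTaylor f x B) (gradient f x + B s) s := by
  rw [hasGradientAt_iff_hasFDerivAt]
  have h1 := ((hasFDerivAt_id s).inner ℝ B.hasFDerivAt).const_mul (1 / 2 : ℝ)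
  have h2 := (innerSL ℝ (gradient f x)).hasFDerivAt (x := s)
  refine ((h2.const_add (f x)).add h1).congr_fderiv ?_
  ext v
  have h3 := (ContinuousLinearMap.isSelfAdjoint_iff_isSymmetric.1 hB) s v
  simp only [ContinuousLinearMap.coe_coe] at h3
  simp [← h3, real_inner_comm (B s) v]
  ring

lemma gradient_approxTaylor (x : E n) {B : Op n} (hB : IsSelfAdjoint B) :
    gradient (approxTaylor f x B) = fun s => gradient f x + B s :=
  gradient_eq (hasGradientAt_approxTaylor x hB)

lemma hess_approxTaylor (x : E n) {B : Op n} (hB : IsSelfAdjoint B) (s : E n) :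
    hess (approxTaylor f x B) s = B := by
  rw [hess, gradient_approxTaylor x hB]
  exact (B.hasFDerivAt.const_add _).fderiv

variable {θ₁ θ₂ σ : ℝ} {x s : E n} {B : Op n}

lemma IsAcceptableStep.model_le (h : IsAcceptableStep f θ₁ θ₂ x B σ s) :
    inner ℝ (gradient f x) s + 1 / 2 * inner ℝ s (B s) + σ / 6 * ‖s‖ ^ 3 ≤ 0 := by
  have := h.1
  simp only [model, approxTaylor, map_zero, inner_zero_right, norm_zero] at this
  linarith

lemma inner_hess_le_add (B : Op n) (x u : E n) :
    inner ℝ u (hess f x u) ≤ inner ℝ u (B u) + ‖B - hess f x‖ * ‖u‖ ^ 2 := by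
  have := (abs_le.1 (abs_inner_apply_le (B - hess f x) u)).1
  rw [sub_apply, inner_sub_right] at this
  linarith

lemma inner_le_inner_hess_add (B : Op n) (x u : E n) :
    inner ℝ u (B u) ≤ inner ℝ u (hess f x u) + ‖B - hess f x‖ * ‖u‖ ^ 2 := by
  have := (abs_le.1 (abs_inner_apply_le (B - hess f x) u)).2
  rw [sub_apply, inner_sub_right] at this
  linarith

lemma IsAcceptableStep.apply_le (h : IsAcceptableStep f θ₁ θ₂ x B σ s) (hf : ContDiff ℝ 2 f)
    (hL : LipschitzWith L (hess f)) :
    f (x + s) ≤ f x - σ / 6 * ‖s‖ ^ 3 + L * ‖s‖ ^ 3 + ‖B - hess f x‖ / 2 * ‖s‖ ^ 2 := by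
  linarith [h.model_le, apply_add_le hf hL x s, inner_hess_le_add (f := f) B x s]

lemma IsAcceptableStep.norm_gradient_le (h : IsAcceptableStep f θ₁ θ₂ x B σ s)
    (hB : IsSelfAdjoint B) (hf : ContDiff ℝ 2 f) (hL : LipschitzWith L (hess f)) :
    ‖gradient f (x + s)‖ ≤ (θ₁ * σ / 2 + L) * ‖s‖ ^ 2 + ‖B - hess f x‖ * ‖s‖ := by
  have h1 := h.2.1
  rw [gradient_approxTaylor x hB] at h1
  have h2 := norm_gradient_add_sub_le hf hL x s
  have h3 : ‖(B - hess f x) s‖ ≤ ‖B - hess f x‖ * ‖s‖ := ContinuousLinearMap.le_opNorm _ _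
  have h4 : gradient f (x + s) = (gradient f x + B s) +
      (gradient f (x + s) - gradient f x - hess f x s) - (B - hess f x) s := by
    rw [sub_apply]; abel
  rw [h4]
  linarith [norm_sub_le ((gradient f x + B s) +
      (gradient f (x + s) - gradient f x - hess f x s)) ((B - hess f x) s),
    norm_add_le (gradient f x + B s) (gradient f (x + s) - gradient f x - hess f x s)]

lemma IsAcceptableStep.neg_le_lambdaMin (h : IsAcceptableStep f θ₁ θ₂ x B σ s)
    (hB : IsSelfAdjoint B) (hL : LipschitzWith L (hess f)) :
    -((θ₂ * σ + L) * ‖s‖ + ‖B - hess f x‖) ≤ lambdaMin (hess f (x + s)) := by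
  have h1 := h.2.2
  rw [hess_approxTaylor x hB] at h1
  have h0 : 0 ≤ θ₂ * σ * ‖s‖ := (le_max_left _ _).trans h1
  have h2 : -(θ₂ * σ * ‖s‖) ≤ lambdaMin B := by linarith [(le_max_right _ _).trans h1]
  have hL' : ‖hess f x - hess f (x + s)‖ ≤ L * ‖s‖ := by
    simpa using hL.norm_sub_le x (x + s)
  refine le_lambdaMin ?_ fun u => ?_
  · have : 0 ≤ L * ‖s‖ := by positivity
    linarith [norm_nonneg (B - hess f x)]
  · have h3 := lambdaMin_mul_sq_le hB u
    have h4 := mul_le_mul_of_nonneg_right h2 (sq_nonneg ‖u‖)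
    have h5 := inner_le_inner_hess_add (f := f) B x u
    have h6 := inner_le_inner_hess_add (f := f) (hess f x) (x + s) u
    have h7 := mul_le_mul_of_nonneg_right hL' (sq_nonneg ‖u‖)
    linarith

/-- A function bounded below has limited negative curvature, which limits the step length. -/
lemma IsAcceptableStep.norm_le (h : IsAcceptableStep f θ₁ θ₂ x B σ s) (hf : ContDiff ℝ 2 f)
    (hL : LipschitzWith L (hess f)) {f_low : ℝ} (hlow : ∀ x, f_low ≤ f x) (hs : 1 ≤ ‖s‖) :
    σ / 6 * ‖s‖ ≤ 2 * ‖gradient f x‖ + (f x - f_low) + L + ‖B - hess f x‖ / 2 := by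
  set r := ‖s‖ with hr
  have hr0 : 0 < r := by linarith
  set u : E n := r⁻¹ • s with hu
  have hsu : s = r • u := by rw [hu, smul_smul, mul_inv_cancel₀ hr0.ne', one_smul]
  have hu1 : ‖u‖ = 1 := by
    rw [hu, norm_smul, norm_inv, Real.norm_of_nonneg hr0.le, ← hr, inv_mul_cancel₀ hr0.ne']
  have h1 := h.model_le
  have hg : inner ℝ (gradient f x) s = r * inner ℝ (gradient f x) u := by
    rw [hsu, real_inner_smul_right]
  have hq : inner ℝ s (B s) = r ^ 2 * inner ℝ u (B u) := by
    rw [hsu, map_smul, real_inner_smul_right, real_inner_smul_left]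
    ring
  rw [← hr, hg, hq] at h1
  have h2 := apply_add_le hf hL x u
  have h3 := inner_hess_le_add (f := f) B x u
  have h4 := (abs_le.1 (abs_real_inner_le_norm (gradient f x) u))
  rw [hu1] at h2 h3 h4
  have h5 := hlow (x + u)
  set g := ‖gradient f x‖
  set p := inner ℝ (gradient f x) u
  set q := inner ℝ u (B u)
  set e := ‖B - hess f x‖
  have h6 : -(f x - f_low + g + L + e / 2) ≤ q / 2 := by linarith
  have h7 : σ / 6 * r ^ 2 ≤ g + r * (f x - f_low + g + L + e / 2) := by
    refine le_of_mul_le_mul_left ?_ hr0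
    nlinarith [mul_le_mul_of_nonneg_left h6 (sq_nonneg r), mul_le_mul_of_nonneg_left h4.1 hr0.le]
  refine le_of_mul_le_mul_left ?_ hr0
  nlinarith [mul_le_mul_of_nonneg_right hs (norm_nonneg (gradient f x))]

end Iteration

/-! ### Accuracy of the Hessian approximations -/

section Accuracy

variable {n : ℕ} {f : E n → ℝ} {L : ℝ≥0} {m : ℕ} {R : Sequences n}

lemma stepLen_natCast (R : Sequences n) (k : ℕ) : stepLen R k = ‖R.s k‖ := by
  simp [stepLen]

lemma stepLen_nonneg (R : Sequences n) (j : ℤ) : 0 ≤ stepLen R j := by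
  unfold stepLen
  split_ifs <;> positivity

lemma window_succ (a : ℤ → ℝ) (M k : ℕ) : window a (M + 1) (k + 1) = a k + window a M k := by
  induction M with
  | zero => simp [window]
  | succ M ih =>
    have h1 : ((k + 1 : ℕ) : ℤ) - ((M + 1 + 1 : ℕ) : ℤ) = k - ((M + 1 : ℕ) : ℤ) := by
      push_cast; ring
    unfold window at ih ⊢
    rw [Finset.sum_Icc_succ_top (by omega), ih, Finset.sum_Icc_succ_top (by omega) (b := M), h1,
      add_assoc]

lemma window_mono {a : ℤ → ℝ} (ha : ∀ j, 0 ≤ a j) {M M' : ℕ} (h : M ≤ M') (k : ℕ) :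
    window a M k ≤ window a M' k :=
  Finset.sum_le_sum_of_subset_of_nonneg (Finset.Icc_subset_Icc_right h) fun _ _ _ => ha _

/-- What exact and finite-difference restarts have in common. -/
def AccurateTensor (f : E n → ℝ) (L : ℝ≥0) (m : ℕ) (R : Sequences n) (k : ℕ) : Prop :=
  if k % m = 0 then
    IsSelfAdjoint (R.B k) ∧ ‖R.B k - hess f (R.x k)‖ ≤ L * window (stepLen R) m k
  else PSBAt f R k

lemma LazyTensor.accurateTensor {k : ℕ} (h : LazyTensor f m R k) (hf : ContDiff ℝ 2 f) :
    AccurateTensor f L m R k := by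
  unfold LazyTensor at h
  unfold AccurateTensor
  split_ifs at h ⊢ with hk
  · rw [h]
    refine ⟨isSelfAdjoint_hess hf _, ?_⟩
    rw [sub_self, norm_zero]
    exact mul_nonneg L.2 (window_nonneg (stepLen_nonneg R) _ _)
  · exact h

lemma FDTensor.accurateTensor {k : ℕ} (h : FDTensor f m R k) (hf : ContDiff ℝ 2 f)
    (hL : LipschitzWith L (hess f)) (hn : 1 ≤ n) : AccurateTensor f L m R k := by
  unfold FDTensor at h
  unfold AccurateTensor
  split_ifs at h ⊢ with hk
  · obtain ⟨hpos, hB⟩ := h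
    rw [hB]
    refine ⟨isSelfAdjoint_symPart _, ?_⟩
    refine (norm_symPart_sub_le _ (isSelfAdjoint_hess hf _)).trans
      ((norm_fdHess_sub_hess_le hf hL _ hpos).trans ?_)
    have hsq : Real.sqrt n ≠ 0 := (Real.sqrt_pos.2 (by exact_mod_cast hn)).ne'
    rw [fdStep, div_mul_cancel₀ _ hsq]
    exact mul_le_mul_of_nonneg_left (min_le_left _ _) L.2
  · exact h

lemma isSelfAdjoint_and_norm_sub_hess_le (hf : ContDiff ℝ 2 f) (hL : LipschitzWith L (hess f))
    (hm : 1 ≤ m) {K : ℕ} (htensor : ∀ k < K, AccurateTensor f L m R k)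
    (hx : ∀ k < K, R.x (k + 1) = R.x k + R.s k) :
    ∀ k < K, IsSelfAdjoint (R.B k) ∧
      ‖R.B k - hess f (R.x k)‖ ≤ 2 * L * window (stepLen R) (m + k % m) k := by
  have hrestart : ∀ k < K, k % m = 0 → IsSelfAdjoint (R.B k) ∧
      ‖R.B k - hess f (R.x k)‖ ≤ 2 * L * window (stepLen R) (m + k % m) k := by
    intro k hk hkm
    have h := htensor k hk
    rw [AccurateTensor, if_pos hkm] at h
    refine ⟨h.1, ?_⟩
    rw [hkm, add_zero]
    have := mul_nonneg L.2 (window_nonneg (stepLen_nonneg R) m k)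
    have h2 := h.2
    rw [NNReal.val_eq_coe] at this
    linarith
  intro k
  induction k with
  | zero => exact fun hk => hrestart 0 hk (Nat.zero_mod m)
  | succ k ih =>
    intro hk
    by_cases hkm : (k + 1) % m = 0
    · exact hrestart _ hk hkm
    · obtain ⟨hsa, herr⟩ := ih (by omega)
      have h := htensor (k + 1) hk
      rw [AccurateTensor, if_neg hkm] at h
      unfold PSBAt at h
      rw [Nat.add_sub_cancel, hx k (by omega)] at h
      refine ⟨h.1.1, ?_⟩
      have h1 := h.norm_sub_le hsa (isSelfAdjoint_avgHess hf hL (R.x k) (R.s k))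
        (avgHess_apply_self hf hL _ _)
      have h2 := norm_avgHess_sub_left_le hL (R.x k) (R.s k)
      have h3 := norm_avgHess_sub_right_le hL (R.x k) (R.s k)
      have hmod : (k + 1) % m = k % m + 1 := by
        have hk' := Nat.mod_add_div k m
        have hlt := Nat.mod_lt k hm
        rcases (Nat.succ_le_of_lt hlt).lt_or_eq with h4 | h4
        · conv_lhs => rw [← hk', add_right_comm, Nat.add_mul_mod_self_left]
          exact Nat.mod_eq_of_lt h4
        · refine absurd ?_ hkm
          rw [← hk', add_right_comm, ← Nat.succ_eq_add_one (k % m), h4]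
          simp
      rw [hmod, ← add_assoc, window_succ, stepLen_natCast, hx k (by omega)]
      rw [norm_sub_rev] at h2
      linarith [norm_sub_le_norm_sub_add_norm_sub (R.B (k + 1)) (avgHess f (R.x k) (R.s k))
          (hess f (R.x k + R.s k)),
        norm_sub_le_norm_sub_add_norm_sub (R.B k) (hess f (R.x k)) (avgHess f (R.x k) (R.s k))]

end Accuracy

/-! ### Complexity -/

section Complexity

variable {n : ℕ} {f : E n → ℝ} {L : ℝ≥0} {m : ℕ} {R : Sequences n}

lemma stepBounds_of_advances {Δ G σ₀ θ₁ θ₂ f_low : ℝ} {x₀ : E n} {K : ℕ} (hm : 1 ≤ m)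
    (hf : ContDiff ℝ 2 f)
    (hlow : ∀ x, f_low ≤ f x) (hL : LipschitzWith L (hess f)) (hΔ : f x₀ - f_low ≤ Δ)
    (hG : ‖gradient f x₀‖ ≤ G) (hx₀ : R.x 0 = x₀) (hσ₀ : R.σ 0 = σ₀)
    (htensor : ∀ k < K, AccurateTensor f L m R k) (hadv : ∀ k < K, Advances f θ₁ θ₂ R k) :
    StepBounds L Δ G σ₀ θ₁ (2 * m) K (stepLen R) R.σ (fun k => f (R.x k) - f_low)
      (fun k => ‖gradient f (R.x k)‖) (fun k => ‖R.B k - hess f (R.x k)‖) where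
  len_nonneg := stepLen_nonneg R
  len_neg j hj := by simp [stepLen, hj.not_ge]
  reg_zero := hσ₀
  gap_zero := by simpa [hx₀] using hΔ
  gap_nonneg k := sub_nonneg.2 (hlow _)
  grad_zero := by simpa [hx₀] using hG
  err_le k hk := by
    refine (isSelfAdjoint_and_norm_sub_hess_le hf hL hm htensor (fun k hk => (hadv k hk).2.1)
      k hk).2.trans ?_
    gcongr
    exact window_mono (stepLen_nonneg R) (by have := Nat.mod_lt k hm; omega) k
  reg_succ k hk := by rw [stepLen_natCast]; exact (hadv k hk).2.2
  gap_succ k hk := by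
    rw [stepLen_natCast, (hadv k hk).2.1]
    linarith [(hadv k hk).1.apply_le hf hL]
  grad_succ k hk := by
    rw [stepLen_natCast, (hadv k hk).2.1]
    exact (hadv k hk).1.norm_gradient_le (isSelfAdjoint_and_norm_sub_hess_le hf hL hm htensor
      (fun k hk => (hadv k hk).2.1) k hk).1 hf hL
  len_le k hk h1 := by
    rw [stepLen_natCast] at h1 ⊢
    exact (hadv k hk).1.norm_le hf hL hlow h1

/-- The number of iterations is bounded independently of the dimension, for every choice of the
Hessian approximations that is accurate at restarts. -/
lemma exists_stationary_index_bound (L : ℝ≥0) (Δ G : ℝ) {σ₀ θ₁ θ₂ : ℝ} {m : ℕ} (hσ₀ : 0 < σ₀)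
    (hθ₁ : 0 ≤ θ₁) (hθ₂ : 0 ≤ θ₂) (hm : 1 ≤ m) :
    ∃ C : ℝ, 0 < C ∧ ∀ (n : ℕ) (f : E n → ℝ) (f_low : ℝ) (x₀ : E n), ContDiff ℝ 2 f →
      (∀ x, f_low ≤ f x) → LipschitzWith L (hess f) → f x₀ - f_low ≤ Δ → ‖gradient f x₀‖ ≤ G →
      ∀ ε₁ ε₂ : ℝ, 0 < ε₁ → ε₁ ≤ 1 → 0 < ε₂ → ∀ (R : Sequences n) (tensor : ℕ → Prop),
      (∀ k, tensor k → AccurateTensor f L m R k) →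
      IsRun f θ₁ θ₂ σ₀ x₀ ε₁ ε₂ R tensor →
      ∃ j : ℕ, IsStationary f ε₁ ε₂ (R.x j) ∧
        (j + 1 : ℝ) ≤ C * max (ε₁ ^ (-(3 / 2) : ℝ)) (ε₂ ^ (-3 : ℝ)) := by
  obtain ⟨C, hC0, hC⟩ := exists_iteration_bound (Δ := Δ) (G := G) (2 * m) L.coe_nonneg hσ₀ hθ₁ hθ₂
  refine ⟨C + 2, by positivity, ?_⟩
  intro n f f_low x₀ hf hlow hL hΔ hG ε₁ ε₂ hε₁ hε₁' hε₂ R tensor htensor hrun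
  set X : ℝ := max (ε₁ ^ (-(3 / 2) : ℝ)) (ε₂ ^ (-3 : ℝ)) with hX
  have hX1 : 1 ≤ X :=
    le_max_of_le_left (Real.one_le_rpow_of_pos_of_le_one_of_nonpos hε₁ hε₁' (by norm_num))
  by_contra! hcon
  set K : ℕ := ⌊C * X⌋₊ + 1 with hK
  have hKlt : C * X < K := by rw [hK]; exact_mod_cast Nat.lt_floor_add_one _
  have hKle : (K : ℝ) ≤ C * X + 1 := by
    rw [hK]; push_cast; linarith [Nat.floor_le (show 0 ≤ C * X by positivity)]
  have hns : ∀ j ≤ K, ¬ IsStationary f ε₁ ε₂ (R.x j) := by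
    intro j hj hst
    have h1 := hcon j hst
    have h2 : (j : ℝ) ≤ K := by exact_mod_cast hj
    linarith
  have hiter : ∀ k < K, tensor k ∧ Advances f θ₁ θ₂ R k := fun k hk =>
    hrun.2.2 k fun j hj => hns j (by omega)
  have hacc : ∀ k < K, AccurateTensor f L m R k := fun k hk => htensor k (hiter k hk).1
  have hadv : ∀ k < K, Advances f θ₁ θ₂ R k := fun k hk => (hiter k hk).2
  have hsb := stepBounds_of_advances hm hf hlow hL hΔ hG hrun.1 hrun.2.1 hacc hadv
  refine absurd (hC K _ _ _ _ _ hsb ε₁ ε₂ hε₁ hε₂ fun k hk => ?_) (not_le.2 hKlt)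
  by_contra! hsmall
  refine hns (k + 1) hk ⟨hsmall.1.le, ?_⟩
  have h1 := (hadv k hk).1.neg_le_lambdaMin (isSelfAdjoint_and_norm_sub_hess_le hf hL hm hacc
      (fun k hk => (hadv k hk).2.1) k hk).1 hL
  have h2 := hsmall.2
  rw [stepLen_natCast] at h2
  rw [(hadv k hk).2.1]
  linarith

lemma evalCount_le {queries : ℕ → List (E n)} {c : ℕ} (h : ∀ k, (queries k).length ≤ c) (j : ℕ) :
    (evalCount queries j : ℝ) ≤ c * (j + 1) := by
  have : evalCount queries j ≤ (j + 1) * c := by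
    simpa [evalCount] using Finset.sum_le_card_nsmul (Finset.range (j + 1)) _ c fun k _ => h k
  calc (evalCount queries j : ℝ) ≤ ((j + 1) * c : ℕ) := by exact_mod_cast this
    _ = _ := by push_cast; ring

end Complexity

end AR2PSB

theorem mainTheorem3 (L : ℝ≥0) (Δ G σ₀ θ₁ θ₂ : ℝ) (m : ℕ)
    (hσ₀ : 0 < σ₀) (hθ₁ : 1 < θ₁) (hθ₂ : 1 < θ₂) (hm : 1 ≤ m) :
    ∃ C : ℝ, 0 < C ∧
      ∀ (n : ℕ), 1 ≤ n →
      ∀ (f : AR2PSB.E n → ℝ) (f_low : ℝ) (x₀ : AR2PSB.E n),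
        ContDiff ℝ 2 f →
        (∀ x, f_low ≤ f x) →
        LipschitzWith L (AR2PSB.hess f) →
        f x₀ - f_low ≤ Δ →
        ‖gradient f x₀‖ ≤ G →
      ∀ (ε₁ ε₂ : ℝ), 0 < ε₁ → ε₁ ≤ 1 → 0 < ε₂ → ε₂ ≤ 1 →
        (∀ R : AR2PSB.Sequences n, AR2PSB.IsLazyRun f m θ₁ θ₂ σ₀ x₀ ε₁ ε₂ R →
          ∃ j : ℕ, AR2PSB.IsStationary f ε₁ ε₂ (R.x j) ∧
            (AR2PSB.evalCount (AR2PSB.lazyGradQueries R) j : ℝ) ≤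
              C * max (ε₁ ^ (-(3 / 2) : ℝ)) (ε₂ ^ (-3 : ℝ)) ∧
            (AR2PSB.evalCount (AR2PSB.lazyHessQueries m R) j : ℝ) ≤
              C * max (ε₁ ^ (-(3 / 2) : ℝ)) (ε₂ ^ (-3 : ℝ))) ∧
        (∀ R : AR2PSB.Sequences n, AR2PSB.IsFDRun f m θ₁ θ₂ σ₀ x₀ ε₁ ε₂ R →
          ∃ j : ℕ, AR2PSB.IsStationary f ε₁ ε₂ (R.x j) ∧
            (AR2PSB.evalCount (AR2PSB.fdGradQueries m R) j : ℝ) ≤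
              C * (n * max (ε₁ ^ (-(3 / 2) : ℝ)) (ε₂ ^ (-3 : ℝ)))) := by
  obtain ⟨C, hC0, hC⟩ := AR2PSB.exists_stationary_index_bound L Δ G (θ₁ := θ₁) (θ₂ := θ₂) hσ₀
    (by linarith) (by linarith) hm
  refine ⟨2 * C, by positivity, ?_⟩
  intro n hn f f_low x₀ hf hlow hL hΔ hG ε₁ ε₂ hε₁ hε₁' hε₂ _
  have hbound := hC n f f_low x₀ hf hlow hL hΔ hG ε₁ ε₂ hε₁ hε₁' hε₂
  have hX : 0 ≤ max (ε₁ ^ (-(3 / 2) : ℝ)) (ε₂ ^ (-3 : ℝ)) := le_max_of_le_left (by positivity)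
  constructor
  · intro R hR
    obtain ⟨j, hj, hjle⟩ := hbound R _ (fun k hk => hk.accurateTensor hf) hR
    have hone : (j + 1 : ℝ) ≤ 2 * C * max (ε₁ ^ (-(3 / 2) : ℝ)) (ε₂ ^ (-3 : ℝ)) := by
      have := mul_nonneg hC0.le hX
      linarith
    refine ⟨j, hj, le_trans ?_ hone, le_trans ?_ hone⟩
    · simpa using AR2PSB.evalCount_le (queries := AR2PSB.lazyGradQueries R) (c := 1)
        (fun k => by simp [AR2PSB.lazyGradQueries]) j
    · simpa using AR2PSB.evalCount_le (queries := AR2PSB.lazyHessQueries m R) (c := 1)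
        (fun k => by unfold AR2PSB.lazyHessQueries; split_ifs <;> simp) j
  · intro R hR
    obtain ⟨j, hj, hjle⟩ := hbound R _ (fun k hk => hk.accurateTensor hf hL hn) hR
    refine ⟨j, hj, ?_⟩
    calc (AR2PSB.evalCount (AR2PSB.fdGradQueries m R) j : ℝ) ≤ ((2 * n : ℕ) : ℝ) * (j + 1) :=
          AR2PSB.evalCount_le (fun k => by
            unfold AR2PSB.fdGradQueries; split_ifs <;> simp <;> omega) j
      _ ≤ ((2 * n : ℕ) : ℝ) * (C * max (ε₁ ^ (-(3 / 2) : ℝ)) (ε₂ ^ (-3 : ℝ))) := by gcongr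
      _ = _ := by push_cast; ring
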